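/- Let $k$ be a field, $n\ge 0$ and $m\ge 1$ integers, and let $Q=k[x_1,\dots,x_n]$ with $\deg x_i=1$. Let $V^{n,m}=\bigoplus_{j\ge 0}Q_{jm}$ be the $m$th Veronese subring of $Q$, and let $S=S^{n,m}$ be the polynomial ring over $k$ with one variable of degree $m$ for each monomial of degree $m$ in $x_1,\dots,x_n$; $S$ acts on $V^{n,m}$ through the homomorphism of graded $k$-algebras $S\to V^{n,m}$ that sends each variable to the corresponding monomial. For a graded $S$-module $M$ let $t^S_i(M)$ denote the largest degree in which $\operatorname{Tor}^S_i(M,k)$ is nonzero ($-\infty$ if it vanishes, $\infty$ if its degrees are unbounded). (1) The monomials of degree $m$ form a minimal set of homogeneous generators of the $k$-algebra $V^{n,m}$, and there is an $i\ge 0$ such that $$t^S_i(V^{n,m})-im=nm-\left\lceil \tfrac{n}{m}\right\rceil m .$$ (2) Suppose that $k$ contains a primitive $m$th root of unity $w$, let $G$ be a cyclic group of order $m$ with generator $g$, and let $V$ be the $n$-dimensional representation of $G$ with basis $x_1,\dots,x_n$ on which $g x_i=w x_i$, so that $G$ acts on $k[V]=Q$ by algebra automorphisms. Then $|G|$ is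 invertible in $k$ and $Q^G=V^{n,m}$. Let $\tau_G(V)$ be the smallest positive degree $d$ such that the ideal of $Q$ generated by the invariants of positive degree contains $Q_d$. If $n=3$ and $m\ge 3$, or $n\ge 4$ and $m\ne 1$, then $\tau_G(V)=|G|$ and $$t^S_i(V^{n,m})>(i+1)\,\tau_G(V)\quad\text{for some } i\ge 0 .$$ In particular Derksen's conjecture, that in the non-modular case $t^{S'}_i(k[V]^G)\le (i+1)\tau_G(V)\le (i+1)|G|$ for all $i$, where $S'$ is the polynomial ring on a minimal set of homogeneous generators of $k[V]^G$ (each variable having the degree of its generator), fails for this representation. -/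

import Mathlib

open scoped TensorProduct

noncomputable section

universe u

/-! ### Graded modules, graded free resolutions, graded Tor and its end

A `ℤ`-grading of a ring or module is given by its family of homogeneous components. -/

section GradedTor

variable {A M N : Type u} [CommRing A] [AddCommGroup M] [Module A M] [AddCommGroup N] [Module A N]

/-- The end of a graded group: the largest degree in which it is nonzero; it is `⊥ = -∞` for the
zero group and `⊤ = ∞` if the degrees are not bounded above. -/
def gradedEnd {T : Type u} [AddCommGroup T] (𝒯 : ℤ → AddSubgroup T) : EReal :=
  sSup ((fun d : ℤ => ((d : ℝ) : EReal)) '' {d : ℤ | 𝒯 d ≠ ⊥})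

/-- The degree `d` component of a free module over a graded ring with basis `b`, where the basis
element `b j` has degree `deg j`. -/
def gradedFreePiece (𝒜 : ℤ → AddSubgroup A) {F ι : Type u} [AddCommGroup F] [Module A F]
    (b : Module.Basis ι A F) (deg : ι → ℤ) (d : ℤ) : AddSubgroup F where
  carrier := {x | ∀ j, b.repr x j ∈ 𝒜 (d - deg j)}
  add_mem' hx hy j := by simpa using (𝒜 _).add_mem (hx j) (hy j)
  zero_mem' j := by simp
  neg_mem' hx j := by simpa using hx j

/-- The degree `d` component of a tensor product of graded modules. -/
def gradedTensorPiece {F : Type u} [AddCommGroup F] [Module A F]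
    (𝓕 : ℤ → AddSubgroup F) (𝒩 : ℤ → AddSubgroup N) (d : ℤ) : AddSubgroup (F ⊗[A] N) :=
  AddSubgroup.closure {z | ∃ a b : ℤ, a + b = d ∧ ∃ x ∈ 𝓕 a, ∃ y ∈ 𝒩 b, x ⊗ₜ[A] y = z}

/-- A graded free resolution `⋯ → F₁ → F₀ → M → 0` of a graded `A`-module `M`: each `Fᵢ` is free
on a homogeneous basis and all maps preserve degrees. -/
structure GradedFreeResolution (𝒜 : ℤ → AddSubgroup A) (ℳ : ℤ → AddSubgroup M) where
  F : ℕ → Type u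
  [addCommGroup : ∀ i, AddCommGroup (F i)]
  [module : ∀ i, Module A (F i)]
  ι : ℕ → Type u
  basis : ∀ i, Module.Basis (ι i) A (F i)
  deg : ∀ i, ι i → ℤ
  d : ∀ i, F (i + 1) →ₗ[A] F i
  ε : F 0 →ₗ[A] M
  d_mem : ∀ i j, d i (basis (i + 1) j) ∈ gradedFreePiece 𝒜 (basis i) (deg i) (deg (i + 1) j)
  ε_mem : ∀ j, ε (basis 0 j) ∈ ℳ (deg 0 j)
  ε_surjective : Function.Surjective ε
  exact_zero : Function.Exact (d 0) ε
  exact_succ : ∀ i, Function.Exact (d (i + 1)) (d i)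

namespace GradedFreeResolution

attribute [instance] addCommGroup module

variable {𝒜 : ℤ → AddSubgroup A} {ℳ : ℤ → AddSubgroup M}

variable (N) in
/-- The cycles of `F ⊗ N` in homological degree `i`. -/
def cycles (F : GradedFreeResolution 𝒜 ℳ) : ∀ i, Submodule A (F.F i ⊗[A] N)
  | 0 => ⊤
  | i + 1 => LinearMap.ker ((F.d i).rTensor N)

variable (N) in
/-- The boundaries of `F ⊗ N` in homological degree `i`. -/
def boundaries (F : GradedFreeResolution 𝒜 ℳ) (i : ℕ) : Submodule A (F.F i ⊗[A] N) :=
  LinearMap.range ((F.d i).rTensor N)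

variable (N) in
/-- `Tor_i^A(M, N)`, computed as the `i`th homology of `F ⊗ N`. -/
abbrev Tor (F : GradedFreeResolution 𝒜 ℳ) (i : ℕ) : Type u :=
  F.cycles N i ⧸ (F.boundaries N i).comap (F.cycles N i).subtype

/-- The component of degree `d` of `Tor_i^A(M, N)`: the classes of the cycles of degree `d`. -/
def torPiece (F : GradedFreeResolution 𝒜 ℳ) (𝒩 : ℤ → AddSubgroup N) (i : ℕ) (d : ℤ) :
    AddSubgroup (F.Tor N i) :=
  ((gradedTensorPiece (gradedFreePiece 𝒜 (F.basis i) (F.deg i)) 𝒩 d).comap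
    (F.cycles N i).subtype.toAddMonoidHom).map
      ((F.boundaries N i).comap (F.cycles N i).subtype).mkQ.toAddMonoidHom

end GradedFreeResolution

/-- The ideal `A₊` generated by the homogeneous elements of positive degree. -/
def irrelevantIdeal (𝒜 : ℤ → AddSubgroup A) : Ideal A :=
  Ideal.span {a | ∃ d : ℤ, 0 < d ∧ a ∈ 𝒜 d}

/-- The grading of `A / A₊` (which is `k` in degree `0`, when `A` is nonnegatively graded
with `A₀ = k`). -/
def residuePiece (𝒜 : ℤ → AddSubgroup A) (d : ℤ) : AddSubgroup (A ⧸ irrelevantIdeal 𝒜) :=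
  (𝒜 d).map (Ideal.Quotient.mk (irrelevantIdeal 𝒜)).toAddMonoidHom

/-- `t_i^A(M)`, the end of `Tor_i^A(M, k)` with `k = A / A₊`. Any two graded free resolutions of
`M` give isomorphic graded groups `Tor_i^A(M, k)`, so that the supremum is over a family with
only one value. -/
def torEnd (𝒜 : ℤ → AddSubgroup A) (ℳ : ℤ → AddSubgroup M) (i : ℕ) : EReal :=
  ⨆ F : GradedFreeResolution 𝒜 ℳ, gradedEnd (F.torPiece (residuePiece 𝒜) i)

end GradedTor

/-! ### Graded subalgebras of a polynomial ring -/

section Subalgebras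

variable {k : Type u} [Field k] {n : ℕ}

/-- The component of degree `d` of a graded subalgebra `R` of `k[x₁, …, xₙ]`, `deg xᵢ = 1`. -/
def subalgebraPiece (R : Subalgebra k (MvPolynomial (Fin n) k)) (d : ℤ) : AddSubgroup R :=
  ((MvPolynomial.weightedHomogeneousSubmodule k (fun _ : Fin n => (1 : ℤ)) d).comap
    R.val.toLinearMap).toAddSubgroup

/-- `f` is a minimal family of homogeneous generators of the algebra `R`, and `f j` has
degree `e j`. -/
structure IsMinimalGenerators (R : Subalgebra k (MvPolynomial (Fin n) k)) {σ : Type}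
    (f : σ → R) (e : σ → ℕ) : Prop where
  pos : ∀ j, 0 < e j
  homogeneous : ∀ j, (f j : MvPolynomial (Fin n) k).IsHomogeneous (e j)
  generate : Algebra.adjoin k (Set.range f) = ⊤
  minimal : ∀ s : Set σ, Algebra.adjoin k (f '' s) = ⊤ → s = Set.univ

/-- `t_i^S(R)`, where `S = k[X_j : j ∈ σ]` is graded by `deg X_j = e j` and acts on `R` through
the algebra homomorphism `X_j ↦ f j`. -/
def syzygyEnd (R : Subalgebra k (MvPolynomial (Fin n) k)) {σ : Type} (f : σ → R) (e : σ → ℕ)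
    (i : ℕ) : EReal :=
  letI : Module (MvPolynomial σ k) R :=
    Module.compHom R (MvPolynomial.aeval f : MvPolynomial σ k →ₐ[k] R).toRingHom
  torEnd
    (fun d => (MvPolynomial.weightedHomogeneousSubmodule k (fun j : σ => (e j : ℤ)) d).toAddSubgroup)
    (subalgebraPiece R) i

end Subalgebras

/-! ### Rings of invariants and Derksen's inequalities -/

section Invariants

variable {k : Type u} [Field k] {n : ℕ} {G : Type*} [Group G]

/-- The automorphism of `k[V] = k[x₁, …, xₙ]` induced by `g`, where the variables `x_j` are
identified with the standard basis of the representation `V = kⁿ`. -/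
def polyAction (ρ : Representation k G (Fin n → k)) (g : G) :
    MvPolynomial (Fin n) k →ₐ[k] MvPolynomial (Fin n) k :=
  MvPolynomial.aeval fun j => ∑ i, ρ g (Pi.single j 1) i • MvPolynomial.X i

/-- The ring of invariants `k[V]^G`. -/
def polyInvariants (ρ : Representation k G (Fin n → k)) :
    Subalgebra k (MvPolynomial (Fin n) k) :=
  ⨅ g : G, AlgHom.equalizer (polyAction ρ g) (AlgHom.id k _)

/-- The ideal of `k[V]` generated by the invariants of positive degree. -/
def hilbertIdeal (ρ : Representation k G (Fin n → k)) : Ideal (MvPolynomial (Fin n) k) :=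
  Ideal.span {p | p ∈ polyInvariants ρ ∧ ∃ d : ℕ, 0 < d ∧ p.IsHomogeneous d}

/-- `τ_G(V)`: the smallest positive degree `d` in which the Hilbert ideal contains every form. -/
def tauG (ρ : Representation k G (Fin n → k)) : ℕ :=
  sInf {d : ℕ | 0 < d ∧ ∀ p : MvPolynomial (Fin n) k, p.IsHomogeneous d → p ∈ hilbertIdeal ρ}

/-- The assertion of Derksen's conjecture for the representation `ρ`:
`t_i^S(R) ≤ (i + 1) τ_G(V) ≤ (i + 1) |G|` for all `i`, where `R = k[V]^G` and `S` is the
polynomial ring on a minimal set of generators of `R`. -/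
def DerksenInequalities (ρ : Representation k G (Fin n → k)) : Prop :=
  ∀ (σ : Type) [Finite σ] (f : σ → polyInvariants ρ) (e : σ → ℕ),
    IsMinimalGenerators (polyInvariants ρ) f e → ∀ i : ℕ,
      syzygyEnd (polyInvariants ρ) f e i ≤ (((i + 1) * tauG ρ : ℕ) : EReal) ∧
        (i + 1) * tauG ρ ≤ (i + 1) * Nat.card G

end Invariants

/-! ### Veronese subrings -/

section Veronese

variable (k : Type u) [Field k] (n m : ℕ)

/-- The Veronese subring `V^{n,m} = ⨁_i k[x₁, …, xₙ]_{im}`. -/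
def veronese : Subalgebra k (MvPolynomial (Fin n) k) :=
  Submodule.toSubalgebra (⨆ i : ℕ, MvPolynomial.homogeneousSubmodule (Fin n) k (i * m))
    (Submodule.mem_iSup_of_mem 0 (by
      rw [zero_mul]
      exact MvPolynomial.isHomogeneous_one (Fin n) k))
    (fun p q hp hq => by
      induction hp using Submodule.iSup_induction' with
      | zero => simp
      | add x y _ _ hx hy => rw [add_mul]; exact Submodule.add_mem _ hx hy
      | mem i x hx =>
        induction hq using Submodule.iSup_induction' with
        | zero => simp
        | add y z _ _ hy hz => rw [mul_add]; exact Submodule.add_mem _ hy hz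
        | mem j y hy =>
          refine Submodule.mem_iSup_of_mem (i + j) ?_
          rw [add_mul]
          exact MvPolynomial.IsHomogeneous.mul hx hy)

/-- The exponents of the monomials of degree `m` in `n` variables. -/
abbrev VeroneseIndex : Type := {s : Fin n →₀ ℕ // s.degree = m}

/-- The monomials of degree `m`; they form the standard basis of `k[x₁, …, xₙ]_m`, so that
`S^{n,m}` is the polynomial ring on variables indexed by them. -/
def veroneseGen (s : VeroneseIndex n m) : veronese k n m :=
  ⟨MvPolynomial.monomial s.1 1, Submodule.mem_iSup_of_mem 1 (by
    rw [one_mul]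
    exact MvPolynomial.isHomogeneous_monomial 1 s.2)⟩

/-- `t_i^{S^{n,m}}(V^{n,m})`. -/
def veroneseSyzygyEnd (i : ℕ) : EReal :=
  syzygyEnd (veronese k n m) (veroneseGen k n m) (fun _ => m) i

end Veronese

end

/-! The pure powers `xᵢᵐ` form a regular sequence on `V = V^{n,m}`, and the top degree of
`V / (x₁ᵐ, …, xₙᵐ)V` is `⌊n(m - 1)/m⌋ m`, so this is the top degree of `H₀` of the resolution modulo
the `n` corresponding variables of `S`. Killing the remaining `c` variables one at a time, each
connecting map raises both the homological degree by one and the top degree by `m`, because an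
element of positive degree annihilates the classes of top degree. Hence
`t_c(V) = ⌊n(m - 1)/m⌋ m + c m`, and `⌊n(m - 1)/m⌋ = n - ⌈n/m⌉`. For the scalar action of a cyclic
group of order `m` the ideal generated by the invariants of positive degree is generated by `Q_m`,
so `τ = m`, and the bound `(c + 1) m` fails as soon as `2 ≤ ⌊n(m - 1)/m⌋`. -/

noncomputable section

universe u v

open DirectSum MvPolynomial RingTheory.Sequence

section GradedModules

variable {ι κ M N : Type*} [DecidableEq ι] [DecidableEq κ] [AddCommGroup M] [AddCommGroup N]

theorem coe_decompose_map (ℳ : ι → AddSubgroup M) (𝒩 : κ → AddSubgroup N) [Decomposition ℳ]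
    [Decomposition 𝒩] (f : M →+ N) {φ : ι → κ} (hφ : Function.Injective φ)
    (hf : ∀ i, ∀ x ∈ ℳ i, f x ∈ 𝒩 (φ i)) (x : M) (i : ι) :
    (decompose 𝒩 (f x) (φ i) : N) = f (decompose ℳ x i) := by
  induction x using Decomposition.inductionOn ℳ with
  | zero => simp
  | @homogeneous j x =>
    obtain rfl | hij := eq_or_ne j i
    · rw [decompose_coe, of_eq_same, decompose_of_mem_same _ (hf j x x.2)]
    · rw [decompose_coe, of_eq_of_ne _ _ _ hij.symm,
        decompose_of_mem_ne _ (hf j x x.2) (hφ.ne hij), AddSubgroup.coe_zero, map_zero]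
  | add x y hx hy =>
    simp only [map_add, decompose_add, DirectSum.add_apply, AddSubgroup.coe_add, hx, hy]

theorem isInternal_of_projections {ℳ : ι → AddSubgroup M} (π : ι → M →+ M)
    (hself : ∀ i, ∀ x ∈ ℳ i, π i x = x) (hother : ∀ i j, i ≠ j → ∀ x ∈ ℳ j, π i x = 0)
    (hspan : ∀ x, x ∈ ⨆ i, ℳ i) : IsInternal ℳ := by
  have hπ (i : ι) (x : ⨁ j, ℳ j) : π i (DirectSum.coeAddMonoidHom ℳ x) = x i := by
    induction x using DirectSum.induction_on with
    | zero => simp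
    | of j x =>
      obtain rfl | hij := eq_or_ne i j
      · rw [coeAddMonoidHom_of, of_eq_same, hself i x x.2]
      · rw [coeAddMonoidHom_of, of_eq_of_ne _ _ _ hij, hother i j hij x x.2, AddSubgroup.coe_zero]
    | add x y hx hy => simp only [map_add, DirectSum.add_apply, AddSubgroup.coe_add, hx, hy]
  constructor
  · refine (injective_iff_map_eq_zero _).2 fun x hx => DFinsupp.ext fun i => Subtype.ext ?_
    rw [← hπ, hx, map_zero]
    rfl
  · rw [← AddMonoidHom.range_eq_top, eq_top_iff]
    refine fun x _ => (iSup_le fun i y hy => ?_ : ⨆ i, ℳ i ≤ _) (hspan x)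
    exact ⟨DirectSum.of _ i ⟨y, hy⟩, coeAddMonoidHom_of _ _ _⟩

theorem coe_decompose_smul {A : Type*} [CommRing A] [Module A M] {𝒜 : ℤ → AddSubgroup A}
    {ℳ : ℤ → AddSubgroup M} [Decomposition ℳ] [SetLike.GradedSMul 𝒜 ℳ] {w : ℤ} {a : A}
    (ha : a ∈ 𝒜 w) (x : M) (e : ℤ) :
    (decompose ℳ (a • x) (w + e) : M) = a • (decompose ℳ x e : M) :=
  coe_decompose_map ℳ ℳ (DistribSMul.toAddMonoidHom M a) (add_right_injective w)
    (fun _ _ => SetLike.GradedSMul.smul_mem ha) x e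

theorem isHomogeneous_ideal_smul_top {A : Type*} [CommRing A] [Module A M] {𝒜 : ℤ → AddSubgroup A}
    [GradedRing 𝒜] {I : Ideal A} (hI : I.IsHomogeneous 𝒜) (ℳ : ℤ → AddSubgroup M)
    [Decomposition ℳ] [SetLike.GradedSMul 𝒜 ℳ] :
    (I • ⊤ : Submodule A M).IsHomogeneous ℳ := by
  classical
  intro e x hx
  induction hx using Submodule.smul_induction_on' with
  | smul a ha x _ =>
    rw [← sum_support_decompose 𝒜 a, Finset.sum_smul, decompose_sum, DFinsupp.finsetSum_apply,
      AddSubgroup.val_finsetSum]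
    refine sum_mem fun d _ => ?_
    rw [← add_sub_cancel d e, coe_decompose_smul (SetLike.coe_mem _)]
    exact Submodule.smul_mem_smul (hI d ha) trivial
  | add x _ y _ hx hy =>
    rw [decompose_add, DirectSum.add_apply, AddSubgroup.coe_add]
    exact add_mem hx hy

end GradedModules

namespace gradedFreePiece

variable {A F ι : Type u} [CommRing A] {𝒜 : ℤ → AddSubgroup A}
  [AddCommGroup F] [Module A F] (b : Module.Basis ι A F) (deg : ι → ℤ)

theorem smul_basis_mem {j : ι} {d : ℤ} {a : A} (ha : a ∈ 𝒜 d) :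
    a • b j ∈ gradedFreePiece 𝒜 b deg (d + deg j) := fun i => by
  classical
  rw [map_smul, b.repr_self, Finsupp.smul_single_one, Finsupp.single_apply]
  split_ifs with h
  · simpa [← h] using ha
  · exact zero_mem _

variable {b deg} in
theorem map_mem {M : Type*} [AddCommGroup M] [Module A M] {ℳ : ℤ → AddSubgroup M}
    [SetLike.GradedSMul 𝒜 ℳ] {f : F →ₗ[A] M} (hf : ∀ j, f (b j) ∈ ℳ (deg j)) {e : ℤ} {x : F}
    (hx : x ∈ gradedFreePiece 𝒜 b deg e) : f x ∈ ℳ e := by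
  rw [← b.linearCombination_repr x, Finsupp.linearCombination_apply, Finsupp.sum, map_sum]
  refine sum_mem fun j _ => ?_
  rw [map_smul]
  simpa using SetLike.GradedSMul.smul_mem (hx j) (hf j)

instance gradedSMul [SetLike.GradedMul 𝒜] : SetLike.GradedSMul 𝒜 (gradedFreePiece 𝒜 b deg) where
  smul_mem {d e} a x ha hx j := by
    rw [map_smul, Finsupp.smul_apply, vadd_eq_add, add_sub_assoc]
    exact SetLike.GradedMul.mul_mem ha (hx j)

variable [GradedRing 𝒜]

theorem isInternal : IsInternal (gradedFreePiece 𝒜 b deg) := by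
  refine isInternal_of_projections
    (fun e => (Finsupp.liftAddHom fun j =>
      (LinearMap.toSpanSingleton A F (b j)).toAddMonoidHom.comp
        (GradedRing.proj 𝒜 (e - deg j))).comp b.repr.toLinearMap.toAddMonoidHom)
    (fun e x hx => ?_) (fun e e' he x hx => ?_) fun x => ?_
  · conv_rhs => rw [← b.linearCombination_repr x, Finsupp.linearCombination_apply]
    exact Finsupp.sum_congr fun j _ => congrArg (· • b j) (decompose_of_mem_same 𝒜 (hx j))
  · refine Finset.sum_eq_zero fun j _ => ?_
    change (decompose 𝒜 (b.repr x j) (e - deg j) : A) • b j = 0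
    rw [decompose_of_mem_ne 𝒜 (hx j) (by simpa using he.symm), zero_smul]
  · classical
    rw [← b.linearCombination_repr x, Finsupp.linearCombination_apply]
    refine sum_mem fun j _ => ?_
    change b.repr x j • b j ∈ _
    rw [← sum_support_decompose 𝒜 (b.repr x j), Finset.sum_smul]
    exact sum_mem fun d _ => AddSubgroup.mem_iSup_of_mem (d + deg j)
      (smul_basis_mem b deg (SetLike.coe_mem _))

instance decomposition : Decomposition (gradedFreePiece 𝒜 b deg) :=
  (isInternal b deg).chooseDecomposition

end gradedFreePiece

theorem mem_sup_span_singleton_smul_top {A N : Type*} [CommRing A] [AddCommGroup N] [Module A N]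
    {I : Ideal A} {a : A} {x : N} :
    x ∈ (I ⊔ Ideal.span {a}) • (⊤ : Submodule A N) ↔
      ∃ z, x - a • z ∈ I • (⊤ : Submodule A N) := by
  rw [Submodule.sup_smul, Submodule.ideal_span_singleton_smul, Submodule.mem_sup]
  constructor
  · rintro ⟨y, hy, _, ⟨z, -, rfl⟩, rfl⟩
    exact ⟨z, by simpa using hy⟩
  · rintro ⟨z, hz⟩
    exact ⟨_, hz, a • z, Submodule.smul_mem_pointwise_smul z a ⊤ trivial, by simp⟩

namespace GradedFreeResolution

variable {A M : Type u} [CommRing A] [AddCommGroup M] [Module A M] {𝒜 : ℤ → AddSubgroup A}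
  {ℳ : ℤ → AddSubgroup M} (F : GradedFreeResolution 𝒜 ℳ)

/-- The component of degree `e` of `Fᵢ`. -/
abbrev piece (i : ℕ) (e : ℤ) : AddSubgroup (F.F i) := gradedFreePiece 𝒜 (F.basis i) (F.deg i) e

/-- The elements of `Fᵢ` that represent cycles of `F / IF`. -/
def cyclesMod (I : Ideal A) : ∀ i, Submodule A (F.F i)
  | 0 => ⊤
  | i + 1 => (I • ⊤ : Submodule A (F.F i)).comap (F.d i)

/-- The elements of `Fᵢ` that represent boundaries of `F / IF`. -/
def boundariesMod (I : Ideal A) (i : ℕ) : Submodule A (F.F i) :=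
  LinearMap.range (F.d i) ⊔ I • ⊤

/-- The degrees in which `Hᵢ(F / IF)` is nonzero, for a homogeneous ideal `I`. -/
def homologyDegrees (I : Ideal A) (i : ℕ) : Set ℤ :=
  {e | ∃ z ∈ F.piece i e, z ∈ F.cyclesMod I i ∧ z ∉ F.boundariesMod I i}

variable {F} {I J : Ideal A} {i : ℕ}

theorem d_d (x : F.F (i + 2)) : F.d i (F.d (i + 1) x) = 0 :=
  (F.exact_succ i _).2 ⟨x, rfl⟩

theorem mem_boundariesMod {x : F.F i} :
    x ∈ F.boundariesMod I i ↔ ∃ y, x - F.d i y ∈ I • (⊤ : Submodule A (F.F i)) := by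
  rw [boundariesMod, Submodule.mem_sup]
  constructor
  · rintro ⟨_, ⟨y, rfl⟩, r, hr, rfl⟩
    exact ⟨y, by simpa using hr⟩
  · rintro ⟨y, hy⟩
    exact ⟨_, ⟨y, rfl⟩, _, hy, add_sub_cancel _ _⟩

theorem boundariesMod_mono (h : I ≤ J) : F.boundariesMod I i ≤ F.boundariesMod J i :=
  sup_le_sup_left (Submodule.smul_mono_left h) _

theorem mem_boundariesMod_zero {z : F.F 0} :
    z ∈ F.boundariesMod I 0 ↔ F.ε z ∈ I • (⊤ : Submodule A M) := by
  have hmap : (I • ⊤ : Submodule A (F.F 0)).map F.ε = I • ⊤ := by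
    rw [Submodule.map_smul'', Submodule.map_top, LinearMap.range_eq_top.2 F.ε_surjective]
  rw [mem_boundariesMod, ← hmap]
  constructor
  · rintro ⟨y, hy⟩
    exact ⟨_, hy, by rw [map_sub, F.exact_zero.apply_apply_eq_zero, sub_zero]⟩
  · rintro ⟨r, hr, h⟩
    obtain ⟨y, hy⟩ := (F.exact_zero (z - r)).1 (by rw [map_sub, h, sub_self])
    exact ⟨y, by rwa [hy, sub_sub_cancel]⟩

/-! If `a` is regular on `F / IF`, the short exact sequence
`0 → F / IF → F / IF → F / (I + (a))F → 0` has a connecting map from `Hᵢ₊₁(F / (I + (a))F)` to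
`Hᵢ(F / IF)`; it sends the class of `x` to that of `z` when `F.d i x - a • z ∈ I • ⊤`. -/

section Connecting

variable {a : A} {x : F.F (i + 1)} {z : F.F i}

theorem mem_cyclesMod_of_connecting
    (ha : ∀ i, IsSMulRegular (F.F i ⧸ (I • ⊤ : Submodule A (F.F i))) a)
    (h : F.d i x - a • z ∈ I • (⊤ : Submodule A (F.F i))) : z ∈ F.cyclesMod I i := by
  cases i with
  | zero => trivial
  | succ i =>
    refine mem_of_isSMulRegular_quotient_of_smul_mem (ha i) ?_
    simpa [d_d] using Submodule.smul_top_le_comap_smul_top I (F.d i) h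

theorem mem_boundariesMod_of_mem_sup (ha : IsSMulRegular (F.F i ⧸ (I • ⊤ : Submodule A (F.F i))) a)
    (h : F.d i x - a • z ∈ I • (⊤ : Submodule A (F.F i)))
    (hx : x ∈ F.boundariesMod (I ⊔ Ideal.span {a}) (i + 1)) : z ∈ F.boundariesMod I i := by
  obtain ⟨y, hy⟩ := mem_boundariesMod.1 hx
  obtain ⟨u, hu⟩ := mem_sup_span_singleton_smul_top.1 hy
  have hdu : F.d i x - a • F.d i u ∈ I • (⊤ : Submodule A (F.F i)) := by
    simpa [d_d] using Submodule.smul_top_le_comap_smul_top I (F.d i) hu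
  refine mem_boundariesMod.2 ⟨u, mem_of_isSMulRegular_quotient_of_smul_mem ha ?_⟩
  simpa [smul_sub] using sub_mem hdu h

theorem mem_boundariesMod_sup_of_mem (hv : F.cyclesMod I (i + 1) ≤ F.boundariesMod I (i + 1))
    (h : F.d i x - a • z ∈ I • (⊤ : Submodule A (F.F i))) (hz : z ∈ F.boundariesMod I i) :
    x ∈ F.boundariesMod (I ⊔ Ideal.span {a}) (i + 1) := by
  obtain ⟨y, hy⟩ := mem_boundariesMod.1 hz
  have hcycle : x - a • y ∈ F.cyclesMod I (i + 1) := by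
    have : F.d i (x - a • y) = (F.d i x - a • z) + a • (z - F.d i y) := by
      rw [map_sub, map_smul, smul_sub]; abel
    change F.d i (x - a • y) ∈ (I • ⊤ : Submodule A (F.F i))
    exact this ▸ add_mem h (Submodule.smul_mem _ _ hy)
  have hay : a • y ∈ F.boundariesMod (I ⊔ Ideal.span {a}) (i + 1) :=
    Submodule.mem_sup_right (mem_sup_span_singleton_smul_top.2 ⟨y, by simp⟩)
  simpa using add_mem (boundariesMod_mono le_sup_left (hv hcycle)) hay

theorem cyclesMod_sup_le_boundariesMod
    (ha : ∀ i, IsSMulRegular (F.F i ⧸ (I • ⊤ : Submodule A (F.F i))) a)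
    (hv : F.cyclesMod I (i + 1) ≤ F.boundariesMod I (i + 1))
    (hinj : ∀ z ∈ F.cyclesMod I i, a • z ∈ F.boundariesMod I i → z ∈ F.boundariesMod I i) :
    F.cyclesMod (I ⊔ Ideal.span {a}) (i + 1) ≤ F.boundariesMod (I ⊔ Ideal.span {a}) (i + 1) := by
  intro x hx
  obtain ⟨z, hz⟩ := mem_sup_span_singleton_smul_top.1 hx
  refine mem_boundariesMod_sup_of_mem hv hz (hinj z (mem_cyclesMod_of_connecting ha hz) ?_)
  exact mem_boundariesMod.2 ⟨x, by simpa using neg_mem hz⟩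

variable [GradedRing 𝒜]

theorem d_decompose (x : F.F (i + 1)) (e : ℤ) :
    F.d i (decompose (F.piece (i + 1)) x e) = decompose (F.piece i) (F.d i x) e :=
  (coe_decompose_map (F.piece (i + 1)) (F.piece i) (F.d i).toAddMonoidHom Function.injective_id
    (fun _ _ => gradedFreePiece.map_mem (F.d_mem i)) x e).symm

theorem decompose_connecting {w : ℤ} (hI : I.IsHomogeneous 𝒜) (haw : a ∈ 𝒜 w)
    (h : F.d i x - a • z ∈ I • (⊤ : Submodule A (F.F i))) (e : ℤ) :
    F.d i (decompose (F.piece (i + 1)) x (w + e)) - a • (decompose (F.piece i) z e : F.F i) ∈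
      I • (⊤ : Submodule A (F.F i)) := by
  simpa [d_decompose, ← coe_decompose_smul haw] using
    isHomogeneous_ideal_smul_top hI (F.piece i) (w + e) h

/-- Multiplication by `a` raises degrees, so it kills the top degree of `Hᵢ(F / IF)`, which is
therefore in the image of the connecting map. -/
theorem isGreatest_homologyDegrees_sup {w D : ℤ}
    (ha : ∀ i, IsSMulRegular (F.F i ⧸ (I • ⊤ : Submodule A (F.F i))) a)
    (hv : F.cyclesMod I (i + 1) ≤ F.boundariesMod I (i + 1)) (hI : I.IsHomogeneous 𝒜)
    (haw : a ∈ 𝒜 w) (hw : 0 < w) (hD : IsGreatest (F.homologyDegrees I i) D) :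
    IsGreatest (F.homologyDegrees (I ⊔ Ideal.span {a}) (i + 1)) (w + D) := by
  constructor
  · obtain ⟨z, hzD, hz, hzb⟩ := hD.1
    have haz : a • z ∈ F.boundariesMod I i := by
      by_contra hb
      have := hD.2 ⟨_, SetLike.GradedSMul.smul_mem haw hzD, Submodule.smul_mem _ _ hz, hb⟩
      exact absurd this (by simpa using hw)
    obtain ⟨x, hx⟩ := mem_boundariesMod.1 haz
    have hx' := decompose_connecting hI haw (by simpa using neg_mem hx) D
    rw [decompose_of_mem_same _ hzD] at hx'
    exact ⟨_, SetLike.coe_mem _, mem_sup_span_singleton_smul_top.2 ⟨z, hx'⟩,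
      fun hb => hzb (mem_boundariesMod_of_mem_sup (ha i) hx' hb)⟩
  · rintro e ⟨x, hxe, hx, hxb⟩
    obtain ⟨z, hz⟩ := mem_sup_span_singleton_smul_top.1 hx
    have hz' := decompose_connecting hI haw hz (e - w)
    rw [add_sub_cancel, decompose_of_mem_same _ hxe] at hz'
    have := hD.2 ⟨_, SetLike.coe_mem _, mem_cyclesMod_of_connecting ha hz',
      fun hb => hxb (mem_boundariesMod_sup_of_mem hv hz' hb)⟩
    linarith

end Connecting

end GradedFreeResolution

section RegularSequences

variable {A N : Type*} [CommRing A] [AddCommGroup N] [Module A N]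

theorem ofList_concat (rs : List A) (a : A) :
    Ideal.ofList (rs ++ [a]) = Ideal.ofList rs ⊔ Ideal.span {a} := by
  rw [Ideal.ofList_append, Ideal.ofList_singleton]

theorem isWeaklyRegular_concat_iff {rs : List A} {a : A} :
    IsWeaklyRegular N (rs ++ [a]) ↔
      IsWeaklyRegular N rs ∧ IsSMulRegular (N ⧸ (Ideal.ofList rs • ⊤ : Submodule A N)) a := by
  rw [isWeaklyRegular_append_iff, isWeaklyRegular_singleton_iff]

theorem isWeaklyRegular_of_flat [Module.Flat A N] {rs : List A} (h : IsWeaklyRegular A rs) :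
    IsWeaklyRegular N rs :=
  ((TensorProduct.rid A N).isWeaklyRegular_congr rs).1 h.isWeaklyRegular_lTensor

end RegularSequences

namespace GradedFreeResolution

variable {A M : Type u} [CommRing A] [AddCommGroup M] [Module A M] {𝒜 : ℤ → AddSubgroup A}
  {ℳ : ℤ → AddSubgroup M} {F : GradedFreeResolution 𝒜 ℳ} {rs ss : List A}

theorem isSMulRegular_of_isWeaklyRegular_concat {a : A} (h : IsWeaklyRegular A (rs ++ [a]))
    (i : ℕ) : IsSMulRegular (F.F i ⧸ (Ideal.ofList rs • ⊤ : Submodule A (F.F i))) a :=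
  have := Module.Free.of_basis (F.basis i)
  (isWeaklyRegular_concat_iff.1 (isWeaklyRegular_of_flat h)).2

theorem cyclesMod_bot_le_boundariesMod (i : ℕ) :
    F.cyclesMod ⊥ (i + 1) ≤ F.boundariesMod ⊥ (i + 1) := by
  intro x hx
  have hx : F.d i x = 0 := by simpa [cyclesMod] using hx
  exact Submodule.mem_sup_left ((F.exact_succ i x).1 hx)

theorem cyclesMod_ofList_le_boundariesMod (hA : IsWeaklyRegular A rs) (hM : IsWeaklyRegular M rs)
    (i : ℕ) :
    F.cyclesMod (Ideal.ofList rs) (i + 1) ≤ F.boundariesMod (Ideal.ofList rs) (i + 1) := by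
  induction rs using List.reverseRecOn generalizing i with
  | nil => simpa using cyclesMod_bot_le_boundariesMod i
  | append_singleton rs a ih =>
    obtain ⟨hM, haM⟩ := isWeaklyRegular_concat_iff.1 hM
    have ih := ih (isWeaklyRegular_concat_iff.1 hA).1 hM
    rw [ofList_concat]
    refine cyclesMod_sup_le_boundariesMod (isSMulRegular_of_isWeaklyRegular_concat hA) (ih i)
      fun z hz hz' => ?_
    cases i with
    | zero =>
      rw [mem_boundariesMod_zero] at hz' ⊢
      exact mem_of_isSMulRegular_quotient_of_smul_mem haM (by rwa [← map_smul])
    | succ i => exact ih i hz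

theorem cyclesMod_append_le_boundariesMod (hA : IsWeaklyRegular A (rs ++ ss))
    (hM : IsWeaklyRegular M rs) {i : ℕ} (hi : ss.length ≤ i) :
    F.cyclesMod (Ideal.ofList (rs ++ ss)) (i + 1) ≤
      F.boundariesMod (Ideal.ofList (rs ++ ss)) (i + 1) := by
  induction ss using List.reverseRecOn generalizing i with
  | nil =>
    rw [List.append_nil] at hA ⊢
    exact cyclesMod_ofList_le_boundariesMod hA hM i
  | append_singleton ss a ih =>
    rw [← List.append_assoc] at hA
    rw [List.length_append, List.length_singleton] at hi
    have ih {i : ℕ} := @ih (isWeaklyRegular_concat_iff.1 hA).1 i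
    obtain ⟨i, rfl⟩ := Nat.exists_eq_add_of_lt hi
    rw [← List.append_assoc, ofList_concat]
    exact cyclesMod_sup_le_boundariesMod (isSMulRegular_of_isWeaklyRegular_concat hA)
      (ih (by lia)) fun z hz _ => ih (by lia) hz

variable [GradedRing 𝒜] [Decomposition ℳ] [SetLike.GradedSMul 𝒜 ℳ]

theorem homologyDegrees_zero (I : Ideal A) :
    F.homologyDegrees I 0 = {e | ∃ v ∈ ℳ e, v ∉ I • (⊤ : Submodule A M)} := by
  ext e
  have hε : ∀ e, ∀ x ∈ F.piece 0 e, F.ε x ∈ ℳ e := fun _ _ => gradedFreePiece.map_mem F.ε_mem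
  constructor
  · rintro ⟨z, hze, -, hz⟩
    exact ⟨F.ε z, hε e z hze, mt mem_boundariesMod_zero.2 hz⟩
  · rintro ⟨v, hv, hvI⟩
    obtain ⟨z, rfl⟩ := F.ε_surjective v
    refine ⟨decompose (F.piece 0) z e, SetLike.coe_mem _, trivial, fun hz => hvI ?_⟩
    have h := coe_decompose_map (F.piece 0) ℳ F.ε.toAddMonoidHom Function.injective_id hε z e
    rw [id, LinearMap.toAddMonoidHom_coe, decompose_of_mem_same _ hv] at h
    exact h ▸ mem_boundariesMod_zero.1 hz

theorem isGreatest_homologyDegrees_append {ι : Type*} {f : ι → A} {l : List ι}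
    (hA : IsWeaklyRegular A (rs ++ l.map f)) (hM : IsWeaklyRegular M rs)
    (hrs : ∀ a ∈ rs, SetLike.IsHomogeneousElem 𝒜 a) {w : ι → ℤ} (hf : ∀ j ∈ l, f j ∈ 𝒜 (w j))
    (hw : ∀ j ∈ l, 0 < w j) {D : ℤ}
    (hD : IsGreatest {e | ∃ v ∈ ℳ e, v ∉ Ideal.ofList rs • (⊤ : Submodule A M)} D) :
    IsGreatest (F.homologyDegrees (Ideal.ofList (rs ++ l.map f)) l.length)
      ((l.map w).sum + D) := by
  induction l using List.reverseRecOn with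
  | nil => simpa [homologyDegrees_zero] using hD
  | append_singleton l j ih =>
    rw [List.map_append, List.map_singleton, ← List.append_assoc] at hA ⊢
    have hA' := (isWeaklyRegular_concat_iff.1 hA).1
    have ih := ih hA' (fun b hb => hf b (by simp [hb])) fun b hb => hw b (by simp [hb])
    have hI : (Ideal.ofList (rs ++ l.map f)).IsHomogeneous 𝒜 := by
      refine Ideal.homogeneous_span 𝒜 _ fun b hb => ?_
      obtain hb | hb := List.mem_append.1 hb
      · exact hrs b hb
      · obtain ⟨c, hc, rfl⟩ := List.mem_map.1 hb
        exact ⟨w c, hf c (by simp [hc])⟩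
    have hsum : ((l ++ [j]).map w).sum + D = w j + ((l.map w).sum + D) := by
      rw [List.map_append, List.sum_append, List.map_singleton, List.sum_singleton]; ring
    rw [ofList_concat, List.length_append, List.length_singleton, hsum]
    exact isGreatest_homologyDegrees_sup (isSMulRegular_of_isWeaklyRegular_concat hA)
      (cyclesMod_append_le_boundariesMod hA' hM (List.length_map f).le) hI
      (hf j (by simp)) (hw j (by simp)) ih

end GradedFreeResolution

section TensorQuotient

variable {A N N' : Type*} [CommRing A] [AddCommGroup N] [Module A N] [AddCommGroup N']
  [Module A N'] (I : Ideal A)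

theorem tmul_one_eq_zero_iff {x : N} :
    x ⊗ₜ[A] (1 : A ⧸ I) = 0 ↔ x ∈ I • (⊤ : Submodule A N) := by
  rw [← (TensorProduct.tensorQuotEquivQuotSMul N I).map_eq_zero_iff,
    ← map_one (Ideal.Quotient.mk I), TensorProduct.tensorQuotEquivQuotSMul_tmul_mk, one_smul,
    Submodule.Quotient.mk_eq_zero]

theorem tmul_mk_eq_smul_tmul_one (x : N) (a : A) :
    x ⊗ₜ[A] (Ideal.Quotient.mk I a) = (a • x) ⊗ₜ[A] 1 := by
  rw [TensorProduct.smul_tmul, Algebra.smul_def, mul_one, Ideal.Quotient.algebraMap_eq]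

theorem exists_tmul_one_eq (z : N ⊗[A] (A ⧸ I)) : ∃ x : N, x ⊗ₜ[A] 1 = z := by
  induction z with
  | zero => exact ⟨0, TensorProduct.zero_tmul _ _⟩
  | tmul x a =>
    obtain ⟨a, rfl⟩ := Ideal.Quotient.mk_surjective a
    exact ⟨_, (tmul_mk_eq_smul_tmul_one I x a).symm⟩
  | add y z hy hz =>
    obtain ⟨x, rfl⟩ := hy
    obtain ⟨x', rfl⟩ := hz
    exact ⟨x + x', TensorProduct.add_tmul _ _ _⟩

theorem tmul_one_mem_range_rTensor_iff (f : N →ₗ[A] N') {x : N'} :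
    x ⊗ₜ[A] (1 : A ⧸ I) ∈ LinearMap.range (f.rTensor (A ⧸ I)) ↔
      x ∈ LinearMap.range f ⊔ I • (⊤ : Submodule A N') := by
  rw [Submodule.mem_sup]
  constructor
  · rintro ⟨z, hz⟩
    obtain ⟨y, rfl⟩ := exists_tmul_one_eq I z
    refine ⟨f y, ⟨y, rfl⟩, x - f y, (tmul_one_eq_zero_iff I).1 ?_, add_sub_cancel _ _⟩
    rw [TensorProduct.sub_tmul, ← hz, LinearMap.rTensor_tmul, sub_self]
  · rintro ⟨_, ⟨y, rfl⟩, r, hr, rfl⟩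
    refine ⟨y ⊗ₜ 1, ?_⟩
    rw [LinearMap.rTensor_tmul, TensorProduct.add_tmul, (tmul_one_eq_zero_iff I).2 hr, add_zero]

end TensorQuotient

theorem gradedEnd_eq_of_isGreatest {T : Type u} [AddCommGroup T] {𝒯 : ℤ → AddSubgroup T} {D : ℤ}
    (hD : IsGreatest {d | 𝒯 d ≠ ⊥} D) : gradedEnd 𝒯 = ((D : ℝ) : EReal) := by
  refine IsLUB.sSup_eq (IsGreatest.isLUB ⟨⟨D, hD.1, rfl⟩, ?_⟩)
  rintro _ ⟨d, hd, rfl⟩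
  simpa using hD.2 hd

namespace GradedFreeResolution

variable {A M : Type u} [CommRing A] [AddCommGroup M] [Module A M] {𝒜 : ℤ → AddSubgroup A}
  {ℳ : ℤ → AddSubgroup M} {F : GradedFreeResolution 𝒜 ℳ} {i : ℕ} {e : ℤ}

theorem tmul_one_mem_cycles_iff {I : Ideal A} {x : F.F i} :
    x ⊗ₜ[A] 1 ∈ F.cycles (A ⧸ I) i ↔ x ∈ F.cyclesMod I i := by
  cases i with
  | zero => exact Iff.rfl
  | succ i =>
    simp only [cycles, cyclesMod, LinearMap.mem_ker, LinearMap.rTensor_tmul, tmul_one_eq_zero_iff,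
      Submodule.mem_comap]

theorem tmul_one_mem_boundaries_iff {I : Ideal A} {x : F.F i} :
    x ⊗ₜ[A] 1 ∈ F.boundaries (A ⧸ I) i ↔ x ∈ F.boundariesMod I i :=
  tmul_one_mem_range_rTensor_iff I (F.d i)

theorem mem_gradedTensorPiece_iff [GradedRing 𝒜] {z : F.F i ⊗[A] (A ⧸ irrelevantIdeal 𝒜)} :
    z ∈ gradedTensorPiece (F.piece i) (residuePiece 𝒜) e ↔ ∃ x ∈ F.piece i e, x ⊗ₜ 1 = z := by
  constructor
  · intro hz
    induction hz using AddSubgroup.closure_induction with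
    | mem z hz =>
      obtain ⟨c, d, rfl, x, hx, _, ⟨a, ha, rfl⟩, rfl⟩ := hz
      refine ⟨a • x, ?_, (tmul_mk_eq_smul_tmul_one _ x a).symm⟩
      rw [add_comm]
      exact SetLike.GradedSMul.smul_mem ha hx
    | zero => exact ⟨0, zero_mem _, TensorProduct.zero_tmul _ _⟩
    | add y z _ _ hy hz =>
      obtain ⟨x, hx, rfl⟩ := hy
      obtain ⟨x', hx', rfl⟩ := hz
      exact ⟨x + x', add_mem hx hx', TensorProduct.add_tmul _ _ _⟩
    | neg z _ hz =>
      obtain ⟨x, hx, rfl⟩ := hz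
      exact ⟨-x, neg_mem hx, TensorProduct.neg_tmul _ _⟩
  · rintro ⟨x, hx, rfl⟩
    exact AddSubgroup.subset_closure
      ⟨e, 0, add_zero e, x, hx, 1, ⟨1, SetLike.GradedOne.one_mem, rfl⟩, rfl⟩

theorem torPiece_ne_bot_iff [GradedRing 𝒜] :
    F.torPiece (residuePiece 𝒜) i e ≠ ⊥ ↔ e ∈ F.homologyDegrees (irrelevantIdeal 𝒜) i := by
  rw [Ne, AddSubgroup.eq_bot_iff_forall]
  push Not
  constructor
  · rintro ⟨_, ⟨⟨z, hzc⟩, hz, rfl⟩, hne⟩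
    obtain ⟨x, hx, rfl⟩ := mem_gradedTensorPiece_iff.1 hz
    refine ⟨x, hx, tmul_one_mem_cycles_iff.1 hzc, fun hb => hne ?_⟩
    exact (Submodule.Quotient.mk_eq_zero _).2 (tmul_one_mem_boundaries_iff.2 hb)
  · rintro ⟨x, hx, hxc, hb⟩
    refine ⟨_, ⟨⟨x ⊗ₜ 1, tmul_one_mem_cycles_iff.2 hxc⟩,
      mem_gradedTensorPiece_iff.2 ⟨x, hx, rfl⟩, rfl⟩, fun h => hb ?_⟩
    exact tmul_one_mem_boundaries_iff.1 (Submodule.mem_comap.1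
      ((Submodule.Quotient.mk_eq_zero ((F.boundaries _ i).comap (F.cycles _ i).subtype)).1 h))

end GradedFreeResolution

section HomogeneousCover

variable {A N : Type u} [CommRing A] [AddCommGroup N] [Module A N]

/-- The homogeneous elements of a submodule, each with its degree. -/
abbrev HomogeneousElement (𝒩 : ℤ → AddSubgroup N) (K : Submodule A N) : Type u :=
  Σ e : ℤ, {x // x ∈ K ∧ x ∈ 𝒩 e}

/-- The free module on the homogeneous elements of a submodule `K`, mapped onto `K`. -/
def homogeneousCover (𝒩 : ℤ → AddSubgroup N) (K : Submodule A N) :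
    (HomogeneousElement 𝒩 K →₀ A) →ₗ[A] N :=
  Finsupp.linearCombination A fun j => (j.2 : N)

variable {𝒩 : ℤ → AddSubgroup N} {K : Submodule A N}

theorem homogeneousCover_basis_mem (j : HomogeneousElement 𝒩 K) :
    homogeneousCover 𝒩 K (Finsupp.basisSingleOne j) ∈ 𝒩 j.1 := by
  rw [homogeneousCover, Finsupp.coe_basisSingleOne, Finsupp.linearCombination_single, one_smul]
  exact j.2.2.2

theorem range_homogeneousCover [Decomposition 𝒩] (hK : K.IsHomogeneous 𝒩) :
    LinearMap.range (homogeneousCover 𝒩 K) = K := by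
  classical
  rw [homogeneousCover, Finsupp.range_linearCombination]
  refine le_antisymm (Submodule.span_le.2 ?_) fun x hx => ?_
  · rintro _ ⟨j, rfl⟩
    exact j.2.2.1
  · rw [← sum_support_decompose 𝒩 x]
    exact sum_mem fun e _ => Submodule.subset_span ⟨⟨e, _, hK e hx, SetLike.coe_mem _⟩, rfl⟩

theorem isHomogeneous_ker_homogeneousCover {𝒜 : ℤ → AddSubgroup A} [GradedRing 𝒜]
    [Decomposition 𝒩] [SetLike.GradedSMul 𝒜 𝒩] :
    (LinearMap.ker (homogeneousCover 𝒩 K)).IsHomogeneous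
      (gradedFreePiece 𝒜 Finsupp.basisSingleOne (Sigma.fst : HomogeneousElement 𝒩 K → ℤ)) := by
  intro e x hx
  have h := coe_decompose_map
    (gradedFreePiece 𝒜 Finsupp.basisSingleOne (Sigma.fst : HomogeneousElement 𝒩 K → ℤ)) 𝒩
    (homogeneousCover 𝒩 K).toAddMonoidHom Function.injective_id
    (fun _ _ => gradedFreePiece.map_mem (f := homogeneousCover 𝒩 K) homogeneousCover_basis_mem) x e
  rw [LinearMap.toAddMonoidHom_coe, LinearMap.mem_ker.1 hx] at h
  simpa using h.symm

end HomogeneousCover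

section Existence

variable {A : Type u} [CommRing A] (𝒜 : ℤ → AddSubgroup A) [GradedRing 𝒜]

/-- A graded free module together with a homogeneous submodule, from which a graded free resolution
is continued. -/
structure HomogeneousSyzygies where
  ι : Type u
  deg : ι → ℤ
  K : Submodule A (ι →₀ A)
  isHomogeneous : K.IsHomogeneous (gradedFreePiece 𝒜 Finsupp.basisSingleOne deg)

variable {𝒜}

namespace HomogeneousSyzygies

/-- The grading of the free module that contains the syzygies. -/
abbrev piece (P : HomogeneousSyzygies 𝒜) : ℤ → AddSubgroup (P.ι →₀ A) :=
  gradedFreePiece 𝒜 Finsupp.basisSingleOne P.deg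

variable (𝒜) in
/-- The relations between the homogeneous elements of a submodule of a graded module. -/
abbrev ofCover {N : Type u} [AddCommGroup N] [Module A N] (𝒩 : ℤ → AddSubgroup N) [Decomposition 𝒩]
    [SetLike.GradedSMul 𝒜 𝒩] (K : Submodule A N) : HomogeneousSyzygies 𝒜 where
  ι := HomogeneousElement 𝒩 K
  deg := Sigma.fst
  K := LinearMap.ker (homogeneousCover 𝒩 K)
  isHomogeneous := isHomogeneous_ker_homogeneousCover

/-- The `i`th syzygies of `P.K`, for the resolution by the free modules on all homogeneous
elements. -/
def iterate (P : HomogeneousSyzygies 𝒜) : ℕ → HomogeneousSyzygies 𝒜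
  | 0 => P
  | i + 1 => ofCover 𝒜 (P.iterate i).piece (P.iterate i).K

theorem exact_homogeneousCover (P : HomogeneousSyzygies 𝒜) {N : Type u} [AddCommGroup N]
    [Module A N] {f : (P.ι →₀ A) →ₗ[A] N} (hf : LinearMap.ker f = P.K) :
    Function.Exact (homogeneousCover P.piece P.K) f :=
  LinearMap.exact_iff.2 (hf.trans (range_homogeneousCover P.isHomogeneous).symm)

end HomogeneousSyzygies

variable {M : Type u} [AddCommGroup M] [Module A M] (ℳ : ℤ → AddSubgroup M) [Decomposition ℳ]
  [SetLike.GradedSMul 𝒜 ℳ]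

theorem nonempty_gradedFreeResolution : Nonempty (GradedFreeResolution 𝒜 ℳ) := by
  obtain ⟨P, ε, hε, hsurj, hker⟩ : ∃ (P : HomogeneousSyzygies 𝒜) (ε : (P.ι →₀ A) →ₗ[A] M),
      (∀ j, ε (Finsupp.basisSingleOne j) ∈ ℳ (P.deg j)) ∧ Function.Surjective ε ∧
        LinearMap.ker ε = P.K :=
    ⟨.ofCover 𝒜 ℳ ⊤, homogeneousCover ℳ ⊤, homogeneousCover_basis_mem,
      LinearMap.range_eq_top.1 (range_homogeneousCover fun _ _ _ => trivial), rfl⟩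
  exact ⟨{
    F := fun i => (P.iterate i).ι →₀ A
    ι := fun i => (P.iterate i).ι
    basis := fun _ => Finsupp.basisSingleOne
    deg := fun i => (P.iterate i).deg
    d := fun i => homogeneousCover (P.iterate i).piece (P.iterate i).K
    ε := ε
    d_mem := fun _ => homogeneousCover_basis_mem
    ε_mem := hε
    ε_surjective := hsurj
    exact_zero := P.exact_homogeneousCover hker
    exact_succ := fun i => (P.iterate (i + 1)).exact_homogeneousCover rfl }⟩

variable {ℳ} in
theorem torEnd_eq_of_isWeaklyRegular {rs : List A} {ι : Type*} {f : ι → A} {l : List ι}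
    (hA : IsWeaklyRegular A (rs ++ l.map f)) (hM : IsWeaklyRegular M rs)
    (hrs : ∀ a ∈ rs, SetLike.IsHomogeneousElem 𝒜 a) {w : ι → ℤ} (hf : ∀ j ∈ l, f j ∈ 𝒜 (w j))
    (hw : ∀ j ∈ l, 0 < w j) (hirr : irrelevantIdeal 𝒜 = Ideal.ofList (rs ++ l.map f)) {D : ℤ}
    (hD : IsGreatest {e | ∃ v ∈ ℳ e, v ∉ Ideal.ofList rs • (⊤ : Submodule A M)} D) :
    torEnd 𝒜 ℳ l.length = ((((l.map w).sum + D : ℤ) : ℝ) : EReal) := by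
  have := nonempty_gradedFreeResolution (𝒜 := 𝒜) ℳ
  refine (iSup_congr fun F => gradedEnd_eq_of_isGreatest ?_).trans ciSup_const
  simp only [GradedFreeResolution.torPiece_ne_bot_iff, hirr]
  exact GradedFreeResolution.isGreatest_homologyDegrees_append hA hM hrs hf hw hD

end Existence

section PolynomialRings

theorem isWeaklyRegular_map_of_nodup {A N ι : Type*} [CommRing A] [AddCommGroup N] [Module A N]
    {f : ι → A}
    (hf : ∀ (s : Set ι) (j : ι), j ∉ s → ∀ v : N,
      f j • v ∈ Ideal.span (f '' s) • (⊤ : Submodule A N) →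
      v ∈ Ideal.span (f '' s) • (⊤ : Submodule A N)) {l : List ι} (hl : l.Nodup) :
    IsWeaklyRegular N (l.map f) := by
  induction l using List.reverseRecOn with
  | nil => exact IsWeaklyRegular.nil A N
  | append_singleton l j ih =>
    obtain ⟨hj, hl⟩ := List.nodup_cons.1 (List.nodup_append_comm.1 hl)
    rw [List.map_append, List.map_singleton, isWeaklyRegular_concat_iff,
      isSMulRegular_quotient_iff_mem_of_smul_mem]
    have hspan : Ideal.ofList (l.map f) = Ideal.span (f '' {i | i ∈ l}) :=
      congrArg Ideal.span (Set.ext fun a => by simp)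
    exact ⟨ih hl, hspan ▸ hf {i | i ∈ l} j hj⟩

variable {R σ : Type*} [CommRing R]

theorem mem_span_X_image_of_X_mul_mem {s : Set σ} {a : σ} (ha : a ∉ s) {p : MvPolynomial σ R}
    (hp : X a * p ∈ Ideal.span (X '' s : Set (MvPolynomial σ R))) :
    p ∈ Ideal.span (X '' s : Set (MvPolynomial σ R)) := by
  classical
  rw [mem_ideal_span_X_image] at hp ⊢
  intro t ht
  obtain ⟨i, hi, hti⟩ := hp (Finsupp.single a 1 + t) (by simpa [support_X_mul] using ht)
  have hai : a ≠ i := fun h => ha (h ▸ hi)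
  exact ⟨i, hi, by simpa [Finsupp.single_apply, hai] using hti⟩

theorem isWeaklyRegular_map_X {l : List σ} (hl : l.Nodup) :
    IsWeaklyRegular (MvPolynomial σ R) (l.map X : List (MvPolynomial σ R)) :=
  isWeaklyRegular_map_of_nodup (fun s a ha p hp => by
    rw [smul_eq_mul, Ideal.mul_top] at hp ⊢
    exact mem_span_X_image_of_X_mul_mem ha hp) hl

variable (R) in
/-- The grading of `R[X_j : j ∈ σ]` in which `X_j` has degree `w j`. -/
abbrev weightedPiece (w : σ → ℤ) (d : ℤ) : AddSubgroup (MvPolynomial σ R) :=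
  (weightedHomogeneousSubmodule R w d).toAddSubgroup

instance weightedPiece.gradedRing (w : σ → ℤ) : GradedRing (weightedPiece R w) where
  one_mem := isWeightedHomogeneous_one R w
  mul_mem := fun _ _ _ _ hp hq => IsWeightedHomogeneous.mul hp hq
  decompose' := (weightedDecomposition R w).decompose'
  left_inv := (weightedDecomposition R w).left_inv
  right_inv := (weightedDecomposition R w).right_inv

theorem irrelevantIdeal_weightedPiece {w : σ → ℤ} (hw : ∀ a, 0 < w a) :
    irrelevantIdeal (weightedPiece R w) = idealOfVars σ R := by
  refine le_antisymm (Ideal.span_le.2 ?_) (Ideal.span_le.2 ?_)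
  · rintro p ⟨d, hd, hp⟩
    rw [idealOfVars, ← Set.image_univ, SetLike.mem_coe, mem_ideal_span_X_image]
    intro t ht
    have hdeg : Finsupp.weight w t = d := hp (mem_support_iff.1 ht)
    obtain ⟨a, ha⟩ := Finsupp.ne_iff.1 (show t ≠ 0 by rintro rfl; simp [hd.ne] at hdeg)
    exact ⟨a, trivial, ha⟩
  · rintro _ ⟨a, rfl⟩
    exact Ideal.subset_span ⟨w a, hw a, isWeightedHomogeneous_X R w a⟩

end PolynomialRings

theorem torEnd_eq_of_isWeaklyRegular_map_X {R : Type u} {σ : Type v} {M : Type (max v u)}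
    [CommRing R] {w : σ → ℤ} (hw : ∀ a, 0 < w a) [AddCommGroup M] [Module (MvPolynomial σ R) M]
    {ℳ : ℤ → AddSubgroup M} [Decomposition ℳ] [SetLike.GradedSMul (weightedPiece R w) ℳ]
    {l l' : List σ} (hnodup : (l ++ l').Nodup) (hmem : ∀ a, a ∈ l ++ l')
    (hreg : IsWeaklyRegular M (l.map X : List (MvPolynomial σ R))) {D : ℤ}
    (hD : IsGreatest {e | ∃ v ∈ ℳ e, v ∉ Ideal.ofList (l.map X : List (MvPolynomial σ R)) •
      (⊤ : Submodule (MvPolynomial σ R) M)} D) :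
    torEnd (weightedPiece R w) ℳ l'.length = ((((l'.map w).sum + D : ℤ) : ℝ) : EReal) := by
  have hX := isWeightedHomogeneous_X R w
  refine torEnd_eq_of_isWeaklyRegular (f := X) ?_ hreg ?_ (fun a _ => hX a) (fun a _ => hw a)
    ?_ hD
  · rw [← List.map_append]
    exact isWeaklyRegular_map_X hnodup
  · intro p hp
    obtain ⟨a, -, rfl⟩ := List.mem_map.1 hp
    exact ⟨w a, hX a⟩
  · rw [irrelevantIdeal_weightedPiece hw, ← List.map_append]
    refine congrArg Ideal.span (Set.ext fun p => ?_)
    simp only [Set.mem_range, Set.mem_ofPred_eq, List.mem_map, hmem, true_and]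

section GradedSubalgebras

theorem isWeightedHomogeneous_aeval {R σ τ M : Type*} [CommSemiring R] [AddCommMonoid M]
    {w : σ → M} {w' : τ → M} {f : τ → MvPolynomial σ R}
    (hf : ∀ a, IsWeightedHomogeneous w (f a) (w' a)) {p : MvPolynomial τ R} {d : M}
    (hp : IsWeightedHomogeneous w' p d) : IsWeightedHomogeneous w (aeval f p) d := by
  rw [aeval_eq_eval₂Hom, coe_eval₂Hom, eval₂_eq]
  refine sum_mem (S := weightedHomogeneousSubmodule R w d) fun t ht => ?_
  rw [← hp (mem_support_iff.1 ht), Finsupp.weight_apply, Finsupp.sum]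
  exact .C_mul (.prod _ _ _ fun a _ => .pow (hf a) _) _

variable {k : Type u} [Field k] {n : ℕ} {R : Subalgebra k (MvPolynomial (Fin n) k)}

theorem weight_one_int_eq_degree {σ : Type*} (t : σ →₀ ℕ) :
    Finsupp.weight (fun _ : σ => (1 : ℤ)) t = t.degree := by
  simp [Finsupp.weight_apply, Finsupp.degree_apply, Finsupp.sum]

theorem mem_subalgebraPiece_iff {d : ℤ} {v : R} : v ∈ subalgebraPiece R d ↔
    ∀ t ∈ (v : MvPolynomial (Fin n) k).support, (t.degree : ℤ) = d := by
  change IsWeightedHomogeneous _ _ _ ↔ _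
  simp only [IsWeightedHomogeneous, weight_one_int_eq_degree, mem_support_iff]
  rfl

theorem isInternal_subalgebraPiece
    (hR : ∀ p ∈ R, ∀ e : ℤ, weightedHomogeneousComponent (fun _ => (1 : ℤ)) e p ∈ R) :
    IsInternal (subalgebraPiece R) := by
  let π (e : ℤ) : R →+ R :=
    ((weightedHomogeneousComponent (fun _ => (1 : ℤ)) e).restrict fun p hp => hR p hp e
      : R.toSubmodule →ₗ[k] R.toSubmodule).toAddMonoidHom
  refine isInternal_of_projections π
    (fun e v hv => Subtype.ext (IsWeightedHomogeneous.weightedHomogeneousComponent_same hv))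
    (fun e e' he v hv => Subtype.ext
      (IsWeightedHomogeneous.weightedHomogeneousComponent_ne e hv he)) fun v => ?_
  have hfin := weightedHomogeneousComponent_finsupp (w := fun _ => (1 : ℤ)) v.1
  have hv : v = ∑ e ∈ Set.Finite.toFinset hfin, π e v := Subtype.ext <|
    (sum_weightedHomogeneousComponent (fun _ => (1 : ℤ)) v.1).symm.trans <|
      (finsum_eq_sum _ hfin).trans (map_sum R.val (π · v) _).symm
  rw [hv]
  exact sum_mem fun e _ => AddSubgroup.mem_iSup_of_mem e
    (weightedHomogeneousComponent_isWeightedHomogeneous (w := fun _ => (1 : ℤ)) e v.1)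

end GradedSubalgebras

section MonomialsOfVeronese

variable {k : Type u} [Field k] {n m : ℕ}

theorem mem_veronese_iff {p : MvPolynomial (Fin n) k} :
    p ∈ veronese k n m ↔ ∀ t ∈ p.support, m ∣ t.degree := by
  constructor
  · intro hp t ht
    change p ∈ ⨆ i : ℕ, homogeneousSubmodule (Fin n) k (i * m) at hp
    by_contra hdvd
    refine mem_support_iff.1 ht ?_
    induction hp using Submodule.iSup_induction' with
    | zero => exact coeff_zero t
    | add p q _ _ hp hq =>
      have coeff_eq_zero {r : MvPolynomial (Fin n) k} (hr : t ∈ r.support → coeff t r = 0) :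
          coeff t r = 0 := by_contra fun h => h (hr (mem_support_iff.2 h))
      rw [coeff_add, coeff_eq_zero hp, coeff_eq_zero hq, add_zero]
    | mem i p hp => exact hp.coeff_eq_zero fun h => hdvd (h ▸ Dvd.intro_left i rfl)
  · intro h
    rw [p.as_sum]
    refine sum_mem fun t ht => ?_
    obtain ⟨i, hi⟩ := h t ht
    exact Submodule.mem_iSup_of_mem i (isHomogeneous_monomial _ (by rw [hi, mul_comm]))

theorem monomial_mem_veronese {t : Fin n →₀ ℕ} (ht : m ∣ t.degree) (c : k) :
    monomial t c ∈ veronese k n m := by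
  classical
  rw [mem_veronese_iff]
  intro s hs
  rwa [Finset.mem_singleton.1 (support_monomial_subset hs)]

theorem mem_addSubgroup_of_monomial_mem {H : AddSubgroup (veronese k n m)} {v : veronese k n m}
    (h : ∀ t ∈ (v : MvPolynomial (Fin n) k).support, ∀ (c : k) (ht : m ∣ t.degree),
      ⟨monomial t c, monomial_mem_veronese ht c⟩ ∈ H) : v ∈ H := by
  have hv : (v : MvPolynomial (Fin n) k) ∈
      H.map (veronese k n m).val.toLinearMap.toAddMonoidHom := by
    rw [(v : MvPolynomial (Fin n) k).as_sum]
    exact sum_mem fun t ht => ⟨_, h t ht _ (mem_veronese_iff.1 v.2 t ht), rfl⟩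
  obtain ⟨v', hv', h'⟩ := hv
  exact (Subtype.ext h' : v' = v) ▸ hv'

instance veronese.decomposition : Decomposition (subalgebraPiece (veronese k n m)) :=
  (isInternal_subalgebraPiece fun p hp e => by
    classical
    rw [mem_veronese_iff, support_weightedHomogeneousComponent]
    exact fun t ht => mem_veronese_iff.1 hp t (Finset.mem_filter.1 ht).1).chooseDecomposition

end MonomialsOfVeronese

section MinimalGenerators

variable {k : Type u} [Field k] {n m : ℕ}

theorem monomial_mem_adjoin_veroneseGen {t : Fin n →₀ ℕ} (ht : m ∣ t.degree) (c : k) :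
    ⟨monomial t c, monomial_mem_veronese ht c⟩ ∈
      Algebra.adjoin k (Set.range (veroneseGen k n m)) := by
  obtain ⟨j, hj⟩ := id ht
  induction j generalizing t with
  | zero =>
    obtain rfl : t = 0 := by rwa [mul_zero, Finsupp.degree_eq_zero_iff] at hj
    exact Subalgebra.algebraMap_mem _ c
  | succ j ih =>
    obtain ⟨s, hst, hs⟩ := Finsupp.exists_le_degree_eq t m (by rw [hj]; nlinarith)
    obtain ⟨r, rfl⟩ := exists_add_of_le hst
    have hr : r.degree = m * j := by
      rw [map_add, hs, mul_add_one, add_comm] at hj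
      exact Nat.add_right_cancel hj
    have hmul : (⟨monomial (s + r) c, monomial_mem_veronese ht c⟩ : veronese k n m) =
        veroneseGen k n m ⟨s, hs⟩ * ⟨monomial r c, monomial_mem_veronese ⟨j, hr⟩ c⟩ :=
      Subtype.ext (by simp [veroneseGen, monomial_mul])
    rw [hmul]
    exact Subalgebra.mul_mem _ (Algebra.subset_adjoin ⟨_, rfl⟩) (ih ⟨j, hr⟩ hr)

theorem adjoin_veroneseGen : Algebra.adjoin k (Set.range (veroneseGen k n m)) = ⊤ := by
  rw [Algebra.eq_top_iff]
  exact fun v => mem_addSubgroup_of_monomial_mem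
    (H := (Algebra.adjoin k (Set.range (veroneseGen k n m))).toSubmodule.toAddSubgroup)
    fun t _ c ht => monomial_mem_adjoin_veroneseGen ht c

theorem eq_zero_or_eq_zero_of_dvd_degree {σ : Type*} {s t : σ →₀ ℕ} (hst : (s + t).degree = m)
    (hs : m ∣ s.degree) : s = 0 ∨ t = 0 := by
  rw [map_add] at hst
  rw [← Finsupp.degree_eq_zero_iff, ← Finsupp.degree_eq_zero_iff]
  obtain h | h := Nat.eq_zero_or_pos s.degree
  · exact .inl h
  · have := Nat.le_of_dvd h hs
    lia

theorem coeff_eq_zero_of_mem_adjoin_veroneseGen (hm : 0 < m) {S : Set (VeroneseIndex n m)}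
    {t : VeroneseIndex n m} (ht : t ∉ S) {v : veronese k n m}
    (hv : v ∈ Algebra.adjoin k (veroneseGen k n m '' S)) :
    coeff t.1 (v : MvPolynomial (Fin n) k) = 0 := by
  classical
  induction hv using Algebra.adjoin_induction with
  | mem v hv =>
    obtain ⟨s, hs, rfl⟩ := hv
    have hst : s.1 ≠ t.1 := fun h => ht (Subtype.ext h ▸ hs)
    simp [veroneseGen, hst]
  | algebraMap c =>
    have h0 : (0 : Fin n →₀ ℕ) ≠ t.1 := fun h => hm.ne' (by rw [← t.2, ← h, map_zero])
    change coeff t.1 (C c) = 0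
    rw [coeff_C, if_neg h0]
  | add x y _ _ hx hy => rw [AddMemClass.coe_add, coeff_add, hx, hy, add_zero]
  | mul x y _ _ hx hy =>
    rw [MulMemClass.coe_mul, coeff_mul]
    refine Finset.sum_eq_zero fun ⟨a, b⟩ hab => ?_
    rw [Finset.HasAntidiagonal.mem_antidiagonal] at hab
    by_cases ha : coeff a (x : MvPolynomial (Fin n) k) = 0
    · rw [ha, zero_mul]
    obtain rfl | rfl := eq_zero_or_eq_zero_of_dvd_degree (hab ▸ t.2)
      (mem_veronese_iff.1 x.2 a (mem_support_iff.2 ha))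
    · rw [show b = t.1 by rw [← hab, zero_add], hy, mul_zero]
    · rw [show a = t.1 by rw [← hab, add_zero], hx, zero_mul]

theorem isMinimalGenerators_veroneseGen (hm : 0 < m) :
    IsMinimalGenerators (veronese k n m) (veroneseGen k n m) (fun _ => m) where
  pos _ := hm
  homogeneous s := isHomogeneous_monomial 1 s.2
  generate := adjoin_veroneseGen
  minimal S hS := by
    refine Set.eq_univ_iff_forall.2 fun t => by_contra fun ht => ?_
    have h := coeff_eq_zero_of_mem_adjoin_veroneseGen (k := k) hm ht
      (v := veroneseGen k n m t) (hS ▸ Algebra.mem_top)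
    simp [veroneseGen] at h

end MinimalGenerators

section VeroneseSyzygies

variable {k : Type u} [Field k] {n m : ℕ}

variable (k n m) in
/-- The polynomial ring `S^{n,m}`. -/
abbrev VeroneseCover : Type u := MvPolynomial (VeroneseIndex n m) k

variable (k n m) in
/-- The action of `S^{n,m}` on the Veronese ring, each variable acting as its monomial. -/
@[reducible] def veroneseModule :
    Module (VeroneseCover k n m) (veronese k n m) :=
  Module.compHom (veronese k n m)
    (aeval (veroneseGen k n m) : VeroneseCover k n m →ₐ[k] veronese k n m).toRingHom

attribute [local instance] veroneseModule

theorem coe_veronese_smul (p : VeroneseCover k n m) (v : veronese k n m) :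
    ((p • v : veronese k n m) : MvPolynomial (Fin n) k) =
      aeval (fun s : VeroneseIndex n m => monomial s.1 (1 : k)) p * v :=
  congrArg (fun q : MvPolynomial (Fin n) k => q * v)
    (DFunLike.congr_fun (comp_aeval (veroneseGen k n m) (veronese k n m).val) p)

theorem coe_X_smul (a : VeroneseIndex n m) (v : veronese k n m) :
    (((X a : VeroneseCover k n m) • v : veronese k n m) :
      MvPolynomial (Fin n) k) = monomial a.1 (1 : k) * v := by
  rw [coe_veronese_smul, aeval_X]

instance veronese.gradedSMul :
    SetLike.GradedSMul (weightedPiece k fun _ : VeroneseIndex n m => (m : ℤ))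
      (subalgebraPiece (veronese k n m)) where
  smul_mem {d e p v} hp hv := by
    change IsWeightedHomogeneous _ ((p • v : veronese k n m) : MvPolynomial (Fin n) k) _
    rw [coe_veronese_smul]
    refine IsWeightedHomogeneous.mul (isWeightedHomogeneous_aeval (fun a => ?_) hp) hv
    exact isWeightedHomogeneous_monomial _ _ _ (by rw [weight_one_int_eq_degree, a.2])

theorem mem_span_X_image_smul_top_iff {s : Set (VeroneseIndex n m)} {v : veronese k n m} :
    v ∈ Ideal.span (X '' s : Set (VeroneseCover k n m)) •
        (⊤ : Submodule (VeroneseCover k n m) (veronese k n m)) ↔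
      ∀ t ∈ (v : MvPolynomial (Fin n) k).support, ∃ a ∈ s, a.1 ≤ t := by
  constructor
  · intro hv
    suffices h : (v : MvPolynomial (Fin n) k) ∈
        Ideal.span ((fun t => monomial t (1 : k)) '' (Subtype.val '' s)) by
      simpa [mem_ideal_span_monomial_image] using h
    induction hv using Submodule.smul_induction_on' with
    | smul p hp v _ =>
      rw [coe_veronese_smul]
      refine Ideal.mul_mem_right _ _ (Ideal.mem_comap.1 ((Ideal.span_le.2 ?_) hp))
      rintro _ ⟨a, ha, rfl⟩
      rw [SetLike.mem_coe, Ideal.mem_comap, aeval_X]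
      exact Ideal.subset_span ⟨a.1, ⟨a, ha, rfl⟩, rfl⟩
    | add x _ y _ hx hy => exact add_mem hx hy
  · intro h
    refine mem_addSubgroup_of_monomial_mem (H := (Ideal.span (X '' s : Set (VeroneseCover k n m)) •
      (⊤ : Submodule (VeroneseCover k n m) (veronese k n m))).toAddSubgroup)
      fun t ht c hdvd => ?_
    obtain ⟨a, ha, hle⟩ := h t ht
    obtain ⟨r, rfl⟩ := exists_add_of_le hle
    have hr : m ∣ r.degree := by
      rw [map_add, a.2] at hdvd
      exact (Nat.dvd_add_right dvd_rfl).1 hdvd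
    have hsmul : (⟨monomial (a.1 + r) c, monomial_mem_veronese hdvd c⟩ : veronese k n m) =
        (X a : VeroneseCover k n m) •
          (⟨monomial r c, monomial_mem_veronese hr c⟩ : veronese k n m) :=
      Subtype.ext (by rw [coe_X_smul, monomial_mul, one_mul])
    rw [hsmul]
    exact Submodule.smul_mem_smul (Ideal.subset_span ⟨a, ha, rfl⟩) trivial

variable (n m) in
/-- The monomial `x_i ^ m` as an element of the monomial basis of the forms of degree `m`. -/
def purePower (i : Fin n) : VeroneseIndex n m := ⟨Finsupp.single i m, Finsupp.degree_single i m⟩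

theorem purePower_injective (hm : 0 < m) : Function.Injective (purePower n m) := fun _ _ h =>
  (Finsupp.single_left_inj hm.ne').1 (congrArg Subtype.val h)

theorem mem_span_X_purePower_image_smul_top_iff {s : Set (Fin n)} {v : veronese k n m} :
    v ∈ Ideal.span ((fun i => (X (purePower n m i) : VeroneseCover k n m)) '' s) •
        (⊤ : Submodule (VeroneseCover k n m) (veronese k n m)) ↔
      ∀ t ∈ (v : MvPolynomial (Fin n) k).support, ∃ i ∈ s, m ≤ t i := by
  rw [← Set.image_image X, mem_span_X_image_smul_top_iff]
  simp only [Set.exists_mem_image, purePower, Finsupp.single_le_iff]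

theorem isWeaklyRegular_map_X_purePower {l : List (Fin n)} (hl : l.Nodup) :
    IsWeaklyRegular (veronese k n m)
      (l.map fun i => (X (purePower n m i) : VeroneseCover k n m)) := by
  refine isWeaklyRegular_map_of_nodup (fun s j hj v hv => ?_) hl
  rw [mem_span_X_purePower_image_smul_top_iff] at hv ⊢
  intro t ht
  obtain ⟨i, hi, hle⟩ := hv (Finsupp.single j m + t) (by
    rw [coe_X_smul, purePower, mem_support_iff, coeff_monomial_mul, one_mul]
    exact mem_support_iff.1 ht)
  have hji : j ≠ i := fun h => hj (h ▸ hi)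
  exact ⟨i, hi, by simpa [Finsupp.single_apply, hji] using hle⟩

theorem isGreatest_degree_of_forall_lt {σ : Type*} [Fintype σ] (hm : 0 < m) :
    IsGreatest {d | ∃ t : σ →₀ ℕ, m ∣ t.degree ∧ (∀ i, t i < m) ∧ t.degree = d}
      (Fintype.card σ * (m - 1) / m * m) := by
  constructor
  · obtain ⟨t, hle, ht⟩ := Finsupp.exists_le_degree_eq
      (Finsupp.equivFunOnFinite.symm fun _ : σ => m - 1) (Fintype.card σ * (m - 1) / m * m) (by
        rw [Finsupp.degree_eq_sum]
        simpa using Nat.div_mul_le_self _ _)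
    refine ⟨t, ht ▸ Dvd.intro_left _ rfl, fun i => ?_, ht⟩
    have := hle i
    rw [Finsupp.equivFunOnFinite_symm_apply_apply] at this
    lia
  · rintro _ ⟨t, ⟨j, hj⟩, hlt, rfl⟩
    have hle : t.degree ≤ Fintype.card σ * (m - 1) := by
      rw [Finsupp.degree_eq_sum, ← smul_eq_mul, Fintype.card]
      exact Finset.sum_le_card_nsmul _ _ _ fun i _ => Nat.le_sub_one_of_lt (hlt i)
    rw [hj, mul_comm m] at hle ⊢
    exact Nat.mul_le_mul_right m ((Nat.le_div_iff_mul_le hm).2 hle)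

theorem isGreatest_degree_veronese_mod_purePowers (hm : 0 < m) :
    IsGreatest {e : ℤ | ∃ v ∈ subalgebraPiece (veronese k n m) e,
      v ∉ Ideal.span (Set.range fun i => (X (purePower n m i) : VeroneseCover k n m)) •
        (⊤ : Submodule (VeroneseCover k n m) (veronese k n m))}
      (n * (m - 1) / m * m : ℕ) := by
  have hgreatest := isGreatest_degree_of_forall_lt (σ := Fin n) hm
  rw [Fintype.card_fin] at hgreatest
  simp only [← Set.image_univ, mem_span_X_purePower_image_smul_top_iff, mem_subalgebraPiece_iff]
  constructor
  · obtain ⟨t, hdvd, hlt, ht⟩ := hgreatest.1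
    refine ⟨⟨monomial t 1, monomial_mem_veronese hdvd 1⟩, by simp [ht], ?_⟩
    simpa [support_monomial] using hlt
  · rintro e ⟨v, hv, hnot⟩
    push Not at hnot
    obtain ⟨t, ht, hlt⟩ := hnot
    rw [← hv t ht]
    exact_mod_cast hgreatest.2
      ⟨t, mem_veronese_iff.1 v.2 t ht, fun i => hlt i trivial, rfl⟩

theorem exists_veroneseSyzygyEnd_eq (hm : 0 < m) : ∃ c : ℕ,
    veroneseSyzygyEnd k n m c = ((n * (m - 1) / m * m + c * m : ℕ) : EReal) := by
  classical
  have : Fintype (VeroneseIndex n m) :=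
    @Fintype.ofFinite _ (Finsupp.finite_of_degree_eq m).to_subtype
  let l := (List.finRange n).map (purePower n m)
  let l' := (Finset.univ \ l.toFinset).toList
  have hnodup : (l ++ l').Nodup :=
    List.nodup_append'.2 ⟨(List.nodup_finRange n).map (purePower_injective hm),
      Finset.nodup_toList _, fun a ha ha' => by simp_all [l']⟩
  have hmap : l.map X = (List.finRange n).map fun i =>
      (X (purePower n m i) : VeroneseCover k n m) := List.map_map
  have hspan : Ideal.ofList (l.map X) = Ideal.span (Set.range fun i =>
      (X (purePower n m i) : VeroneseCover k n m)) :=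
    congrArg Ideal.span (Set.ext fun p => by simp [hmap])
  refine ⟨l'.length, (torEnd_eq_of_isWeaklyRegular_map_X (w := fun _ => (m : ℤ))
    (fun _ => Int.natCast_pos.2 hm) hnodup (fun a => by simp [l', em]) ?_
    (hspan ▸ isGreatest_degree_veronese_mod_purePowers hm)).trans ?_⟩
  · exact hmap ▸ isWeaklyRegular_map_X_purePower (List.nodup_finRange n)
  · rw [List.map_const', List.sum_replicate, nsmul_eq_mul, add_comm]
    norm_cast

end VeroneseSyzygies

section ScalarAction

theorem exists_monoidHom_apply_eq {G H : Type*} [Group G] [Group H] {g : G}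
    (hg : Subgroup.zpowers g = ⊤) {h : H} (hh : h ^ Nat.card G = 1) :
    ∃ χ : G →* H, χ g = h := by
  have hgen : ∀ x, x ∈ Subgroup.zpowers g := fun x => hg ▸ Subgroup.mem_top x
  have horder : orderOf h ∣ orderOf g :=
    orderOf_eq_card_of_forall_mem_zpowers hgen ▸ orderOf_dvd_of_pow_eq_one hh
  exact ⟨monoidHomOfForallMemZpowers hgen horder, monoidHomOfForallMemZpowers_apply_gen hgen horder⟩

variable {k : Type u} [Field k] {n m : ℕ} {G : Type*} [Group G]

/-- The representation on `kⁿ` in which a group acts through a character by scalars. -/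
def scalarRepresentation (n : ℕ) (χ : G →* kˣ) : Representation k G (Fin n → k) :=
  ((algebraMap k (Module.End k (Fin n → k))).toMonoidHom.comp (Units.coeHom k)).comp χ

theorem scalarRepresentation_apply (χ : G →* kˣ) (g : G) :
    scalarRepresentation n χ g = (χ g : k) • LinearMap.id :=
  Algebra.algebraMap_eq_smul_one (A := Module.End k (Fin n → k)) (χ g : k)

theorem polyAction_scalarRepresentation_X (χ : G →* kˣ) (g : G) (j : Fin n) :
    polyAction (scalarRepresentation n χ) g (X j) = C (χ g : k) * X j := by
  simp [polyAction, scalarRepresentation_apply, Pi.single_apply, smul_eq_C_mul]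

theorem polyAction_scalarRepresentation_monomial (χ : G →* kˣ) (g : G) (t : Fin n →₀ ℕ) (c : k) :
    polyAction (scalarRepresentation n χ) g (monomial t c) =
      monomial t ((χ g : k) ^ t.degree * c) := by
  rw [monomial_eq, map_mul, Finsupp.prod, map_prod]
  simp only [map_pow, polyAction_scalarRepresentation_X, mul_pow, Finset.prod_mul_distrib,
    Finset.prod_pow_eq_pow_sum]
  rw [monomial_eq, Finsupp.prod, Finsupp.degree_apply, C_mul, C_pow, ← algebraMap_eq,
    AlgHom.commutes]
  ring

theorem coeff_polyAction_scalarRepresentation (χ : G →* kˣ) (g : G) (p : MvPolynomial (Fin n) k)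
    (t : Fin n →₀ ℕ) :
    coeff t (polyAction (scalarRepresentation n χ) g p) = (χ g : k) ^ t.degree * coeff t p := by
  classical
  induction p using MvPolynomial.induction_on' with
  | add p q hp hq => simp only [map_add, coeff_add, hp, hq, mul_add]
  | monomial s c =>
    rw [polyAction_scalarRepresentation_monomial, coeff_monomial, coeff_monomial]
    split_ifs with h
    · rw [h]
    · rw [mul_zero]

theorem mem_polyInvariants_iff {ρ : Representation k G (Fin n → k)} {p : MvPolynomial (Fin n) k} :
    p ∈ polyInvariants ρ ↔ ∀ g, polyAction ρ g p = p := by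
  simp [polyInvariants, Algebra.mem_iInf, AlgHom.mem_equalizer]

theorem polyInvariants_scalarRepresentation {χ : G →* kˣ} {g : G}
    (hχ : IsPrimitiveRoot (χ g) m) (hg : Subgroup.zpowers g = ⊤) :
    polyInvariants (scalarRepresentation n χ) = veronese k n m := by
  ext p
  rw [mem_polyInvariants_iff, mem_veronese_iff]
  constructor
  · intro h t ht
    have hcoeff := congrArg (coeff t) (h g)
    rw [coeff_polyAction_scalarRepresentation] at hcoeff
    exact hχ.dvd_of_pow_eq_one _
      (Units.ext ((mul_eq_right₀ (mem_support_iff.1 ht)).1 hcoeff))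
  · intro h x
    obtain ⟨z, rfl⟩ : x ∈ Subgroup.zpowers g := hg ▸ Subgroup.mem_top x
    ext t
    rw [coeff_polyAction_scalarRepresentation]
    by_cases ht : coeff t p = 0
    · rw [ht, mul_zero]
    · have hpow : χ (g ^ z) ^ t.degree = 1 := by
        rw [map_zpow, ← zpow_natCast, zpow_comm, zpow_natCast,
          (hχ.pow_eq_one_iff_dvd _).2 (h t (mem_support_iff.2 ht)), one_zpow]
      rw [← Units.val_pow_eq_pow_val, hpow, Units.val_one, one_mul]

end ScalarAction

section Derksen

variable {k : Type u} [Field k] {n m : ℕ} {G : Type*} [Group G] {ρ : Representation k G (Fin n → k)}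

theorem le_degree_of_mem_hilbertIdeal (hρ : polyInvariants ρ = veronese k n m)
    {p : MvPolynomial (Fin n) k} (hp : p ∈ hilbertIdeal ρ) {t : Fin n →₀ ℕ} (ht : t ∈ p.support) :
    m ≤ t.degree := by
  have hle : hilbertIdeal ρ ≤
      Ideal.span ((fun t => monomial t (1 : k)) '' {t : Fin n →₀ ℕ | m ≤ t.degree}) := by
    refine Ideal.span_le.2 ?_
    rintro q ⟨hq, d, hd, hqd⟩
    rw [SetLike.mem_coe, mem_ideal_span_monomial_image]
    intro s hs
    have hsd : s.degree = d := by_contra fun h => mem_support_iff.1 hs (hqd.coeff_eq_zero h)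
    exact ⟨s, Nat.le_of_dvd (hsd ▸ hd) (mem_veronese_iff.1 (hρ ▸ hq) s hs), le_rfl⟩
  obtain ⟨s, hs, hst⟩ := mem_ideal_span_monomial_image.1 (hle hp) t ht
  exact le_trans hs (Finsupp.degree_mono hst)

theorem tauG_eq_of_polyInvariants_eq_veronese (hn : 0 < n) (hm : 0 < m)
    (hρ : polyInvariants ρ = veronese k n m) : tauG ρ = m := by
  refine IsLeast.csInf_eq ⟨⟨hm, fun p hp => Ideal.subset_span ⟨?_, m, hm, hp⟩⟩, ?_⟩
  · rw [hρ]
    exact Submodule.mem_iSup_of_mem 1 (by rwa [one_mul])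
  · rintro d ⟨-, h⟩
    have hd : (Finsupp.single (⟨0, hn⟩ : Fin n) d).degree = d := Finsupp.degree_single _ _
    exact hd ▸ le_degree_of_mem_hilbertIdeal hρ (h (monomial _ 1) (isHomogeneous_monomial 1 hd))
      (by simp)

theorem not_derksenInequalities_of_lt (hm : 0 < m) (hρ : polyInvariants ρ = veronese k n m)
    {i : ℕ} (hi : (((i + 1) * tauG ρ : ℕ) : EReal) < veroneseSyzygyEnd k n m i) :
    ¬ DerksenInequalities ρ := by
  intro h
  have : Finite (VeroneseIndex n m) := (Finsupp.finite_of_degree_eq m).to_subtype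
  rw [DerksenInequalities, hρ] at h
  exact (h _ (veroneseGen k n m) (fun _ => m) (isMinimalGenerators_veroneseGen hm) i).1.not_gt hi

end Derksen

section Arithmetic

theorem natCast_mul_sub_one_div_mul (n : ℕ) {m : ℕ} (hm : 0 < m) :
    ((n * (m - 1) / m * m : ℕ) : ℝ) = n * m - (⌈(n : ℝ) / m⌉ : ℝ) * m := by
  have hceil : ⌈(n : ℝ) / m⌉ = -(-(n : ℤ) / m) := by
    rw [← Rat.ceil_natCast_div_natCast, ← Rat.ceil_cast (α := ℝ)]
    push_cast
    rfl
  have hdiv : ((n * (m - 1) / m : ℕ) : ℤ) = n + -(n : ℤ) / m := by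
    rw [add_comm (n : ℤ), ← Int.add_mul_ediv_right _ _ (Int.natCast_ne_zero.2 hm.ne'),
      Int.natCast_div, Nat.cast_mul, Nat.cast_pred hm]
    ring_nf
  rw [hceil, Nat.cast_mul, ← Int.cast_natCast (R := ℝ) (n * (m - 1) / m), hdiv]
  push_cast
  ring

theorem two_le_mul_sub_one_div {n m : ℕ} (hm : 0 < m) (h : n = 3 ∧ 3 ≤ m ∨ 4 ≤ n ∧ m ≠ 1) :
    2 ≤ n * (m - 1) / m := by
  rw [Nat.le_div_iff_mul_le hm]
  obtain ⟨rfl, h⟩ | ⟨h, h'⟩ := h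
  · lia
  · have := Nat.mul_le_mul_right (m - 1) h
    lia

end Arithmetic

end

theorem mainTheorem3 {k : Type*} [Field k] (n m : ℕ) (hm : 0 < m) :
    (IsMinimalGenerators (veronese k n m) (veroneseGen k n m) (fun _ => m) ∧
      ∃ i : ℕ, veroneseSyzygyEnd k n m i - ((((i : ℝ) * m : ℝ)) : EReal) =
        (((n : ℝ) * m - (⌈(n : ℝ) / m⌉ : ℝ) * m : ℝ) : EReal)) ∧
    ∀ (w : k), IsPrimitiveRoot w m →
      ∀ {G : Type*} [Group G] (g : G), Subgroup.zpowers g = ⊤ → Nat.card G = m →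
        ∃ ρ : Representation k G (Fin n → k),
          ρ g = w • LinearMap.id ∧
          (Nat.card G : k) ≠ 0 ∧
          polyInvariants ρ = veronese k n m ∧
          ((n = 3 ∧ 3 ≤ m ∨ 4 ≤ n ∧ m ≠ 1) →
            tauG ρ = Nat.card G ∧
            (∃ i : ℕ, (((i + 1) * tauG ρ : ℕ) : EReal) < veroneseSyzygyEnd k n m i) ∧
            ¬ DerksenInequalities ρ) := by
  obtain ⟨c, hc⟩ := exists_veroneseSyzygyEnd_eq (k := k) (n := n) hm
  refine ⟨⟨isMinimalGenerators_veroneseGen hm, c, ?_⟩, ?_⟩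
  · rw [hc, ← natCast_mul_sub_one_div_mul n hm, ← EReal.coe_coe_eq_natCast, ← EReal.coe_sub,
      Nat.cast_add, Nat.cast_mul c m, add_sub_cancel_right]
  · rintro w hw G _ g hg rfl
    obtain ⟨u, rfl⟩ := hw.isUnit hm.ne'
    rw [IsPrimitiveRoot.coe_units_iff] at hw
    obtain ⟨χ, rfl⟩ := exists_monoidHom_apply_eq hg hw.pow_eq_one
    have hρ := polyInvariants_scalarRepresentation (n := n) hw hg
    have : NeZero (Nat.card G) := ⟨hm.ne'⟩
    refine ⟨scalarRepresentation n χ, scalarRepresentation_apply χ g,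
      (IsPrimitiveRoot.coe_units_iff.2 hw).neZero'.out, hρ, fun h => ?_⟩
    have htau := tauG_eq_of_polyInvariants_eq_veronese (by lia) hm hρ
    have hlt : (((c + 1) * tauG (scalarRepresentation n χ) : ℕ) : EReal) <
        veroneseSyzygyEnd k n (Nat.card G) c := by
      rw [htau, hc, EReal.natCast_lt_iff, add_one_mul]
      have := Nat.mul_le_mul_right (Nat.card G) (two_le_mul_sub_one_div hm h)
      lia
    exact ⟨htau, ⟨c, hlt⟩, not_derksenInequalities_of_lt hm hρ hlt⟩
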